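/- Let $k$ be a field of characteristic zero. Let $\mathcal Y_n$ be the set of planar binary trees with $n$ internal nodes, let $\mathcal Y_\bullet=\bigcup_{n\ge 0}\mathcal Y_n$, and write $|t|$ for the number of nodes of $t$. A *bi-leveled tree* is a planar binary tree with at least one node, some of whose nodes are circled, such that (i) the leftmost node is circled and has no circled children, and (ii) the parent of a circled node is circled. Let $\mathcal M_\bullet$ be the set of bi-leveled trees and let $\phi$ be the map from trees with circled nodes to $\mathcal Y_\bullet$ that forgets the circles. A *$p$-splitting* $t\stackrel{\curlyvee}{\to}(t_0,\dots,t_p)$ is the sequence of $p+1$ trees obtained by choosing $p$ leaves of $t$, with repetition allowed, and splitting $t$ along the paths from these leaves down to the root; nodes keep their circles. A *restricted $p$-splitting* $t\stackrel{\curlyvee_+}{\to}(t_0,\dots,t_p)$ is a $p$-splitting with $|t_0|>0$. For a tree $s$ with $p$ nodes, the *grafting* $(t_0,\dots,t_p)/s$ is the tree obtained by attaching the root of $t_i$ to the $i$-th leaf of $s$, for $0\le i\le p$. Let $\mathcal YSym$ be the $k$-vector space with basis $\{F_t\}_{t\in\mathcal Y_\bullet}$ and, for $t\in\mathcal Y_\bullet$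 and $s\in\mathcal Y_p$, with product and coproduct $$F_t\cdot F_s=\sum_{t\stackrel{\curlyvee}{\to}(t_0,\dots,t_p)}F_{(t_0,\dots,t_p)/s},\qquad \Delta(F_t)=\sum_{t\stackrel{\curlyvee}{\to}(t_0,t_1)}F_{t_0}\otimes F_{t_1},$$ with unit $1=F_{|}$, where $|$ is the tree without nodes, and with counit $\varepsilon(F_t)=1$ if $|t|=0$ and $\varepsilon(F_t)=0$ otherwise. Let $\mathcal MSym$ be the $k$-vector space with basis $\{F_b\}_{b\in\mathcal M_\bullet}$. For $b\in\mathcal M_\bullet$ and $s\in\mathcal Y_p$ put $$F_b\cdot F_s=\sum_{b\stackrel{\curlyvee_+}{\to}(b_0,\dots,b_p)}F_{(b_0,\dots,b_p)/s},\qquad \rho(F_b)=\sum_{b\stackrel{\curlyvee_+}{\to}(b_0,b_1)}F_{b_0}\otimes F_{\phi(b_1)},$$ where in $(b_0,\dots,b_p)/s$ every node originating in $s$ is circled. Extend these formulas linearly to maps $\cdot:\mathcal MSym\otimes\mathcal YSym\to\mathcal MSym$ and $\rho:\mathcal MSym\to\mathcal MSym\otimes\mathcal YSym$. **Theorem.**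 The action is associative and unital: $(m\cdot g)\cdot h=m\cdot(g\cdot h)$ and $m\cdot 1=m$ for all $m\in\mathcal MSym$ and $g,h\in\mathcal YSym$. The coaction is coassociative and counital: $(\rho\otimes\mathrm{id})\circ\rho=(\mathrm{id}\otimes\Delta)\circ\rho$ and $(\mathrm{id}\otimes\varepsilon)\circ\rho=\mathrm{id}$. Moreover $\rho(m\cdot h)=\rho(m)\cdot\Delta(h)$ for all $m\in\mathcal MSym$ and $h\in\mathcal YSym$, where $(m\otimes g)\cdot(h\otimes h')=(m\cdot h)\otimes(g\cdot h')$; in particular $\rho(F_b\cdot F_s)=\rho(F_b)\cdot\Delta(F_s)$ for all $b\in\mathcal M_\bullet$ and $s\in\mathcal Y_\bullet$. That is, $\mathcal MSym$ is a right Hopf module over the Hopf algebra $\mathcal YSym$. -/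

import Mathlib

open scoped TensorProduct

/-! ### Splittings and graftings of planar binary trees

Planar binary trees are Mathlib's `BinaryTree α`: `nil` is the tree with one leaf and no internal
node, `node a l r` has a root decorated by `a`.  Plain trees are `BinaryTree Unit`; trees whose
nodes may be circled are `BinaryTree Bool` (`true` means circled). -/

namespace PlanarTree

variable {α : Type*}

/-- All ways to choose one leaf of a tree and to split the tree along the path from this leaf down
to the root, as the list of pairs (left piece, right piece), the leaves being taken from left to
right.  Every node stays on its side of the path and keeps its decoration. -/
def split : BinaryTree α → List (BinaryTree α × BinaryTree α)
  | .nil => [(.nil, .nil)]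
  | .node a l r =>
      (split l).map (fun x => (x.1, .node a x.2 r)) ++
        (split r).map (fun x => (.node a l x.1, x.2))

/-- All `p`-splittings of a tree, that is, the forests `[t₀, …, t_p]` obtained by choosing `p`
leaves, with repetition allowed, and splitting along all of them.  The leftmost chosen leaf is split
first; the other chosen leaves, the same leaf among them if it is chosen again, are then leaves of
the right piece. -/
def splittings : ℕ → BinaryTree α → List (List (BinaryTree α))
  | 0, t => [[t]]
  | p + 1, t => (split t).flatMap fun x => (splittings p x.2).map fun f => x.1 :: f

/-- The grafting `(t₀, …, t_p) / s` of a forest onto a tree `s` with `p` nodes: the root of `tᵢ` is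
attached to the `i`-th leaf of `s`. -/
def graft : List (BinaryTree α) → BinaryTree α → BinaryTree α
  | f, .nil => f.headD .nil
  | f, .node a l r => .node a (graft (f.take l.numLeaves) l) (graft (f.drop l.numLeaves) r)

/-- The `p`-splittings `[t₀, …, t_p]` whose first piece `t₀` has at least one node. -/
def restrictedSplittings (p : ℕ) (t : BinaryTree α) : List (List (BinaryTree α)) :=
  (splittings p t).filter fun f => 0 < (f.headD .nil).numNodes

/-- The `1`-splittings `(t₀, t₁)` whose first piece `t₀` has at least one node. -/
def restrictedSplit (t : BinaryTree α) : List (BinaryTree α × BinaryTree α) :=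
  (split t).filter fun x => 0 < x.1.numNodes

/-! ### Bi-leveled trees -/

/-- The tree is not a single leaf and its root is circled. -/
def RootCircled : BinaryTree Bool → Prop
  | .nil => False
  | .node c _ _ => c = true

/-- If a node is circled, then so is its parent. -/
def CirclesUpClosed : BinaryTree Bool → Prop
  | .nil => True
  | .node c l r =>
      (RootCircled l → c = true) ∧ (RootCircled r → c = true) ∧
        CirclesUpClosed l ∧ CirclesUpClosed r

/-- There is a leftmost node, it is circled and it has no circled children.  (The leftmost node has
no left child.) -/
def LeftmostCircled : BinaryTree Bool → Prop
  | .nil => False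
  | .node c .nil r => c = true ∧ ¬ RootCircled r
  | .node _ (.node c l r) _ => LeftmostCircled (.node c l r)

/-- A tree with some nodes circled is bi-leveled. -/
def IsBilevel (t : BinaryTree Bool) : Prop :=
  LeftmostCircled t ∧ CirclesUpClosed t

/-- Forget all circles. -/
def forget (t : BinaryTree Bool) : BinaryTree Unit := t.map fun _ => ()

/-- Circle all nodes. -/
def circleAll (s : BinaryTree Unit) : BinaryTree Bool := s.map fun _ => true

/-! ### Splitting and grafting preserve bi-leveled trees -/

lemma rootCircled_of_split {t : BinaryTree Bool} (ht : CirclesUpClosed t) :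
    ∀ x ∈ split t, (RootCircled x.1 → RootCircled t) ∧ (RootCircled x.2 → RootCircled t) := by
  induction t with
  | nil => simp [split]
  | node c l r ihl ihr =>
    obtain ⟨hl, hr, hul, hur⟩ := ht
    intro x hx
    simp only [split, List.mem_append, List.mem_map] at hx
    rcases hx with ⟨y, hy, rfl⟩ | ⟨y, hy, rfl⟩
    · exact ⟨fun h => hl ((ihl hul y hy).1 h), fun h => h⟩
    · exact ⟨fun h => h, fun h => hr ((ihr hur y hy).2 h)⟩

lemma circlesUpClosed_of_split {t : BinaryTree Bool} (ht : CirclesUpClosed t) :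
    ∀ x ∈ split t, CirclesUpClosed x.1 ∧ CirclesUpClosed x.2 := by
  induction t with
  | nil => simp [split, CirclesUpClosed]
  | node c l r ihl ihr =>
    obtain ⟨hl, hr, hul, hur⟩ := ht
    intro x hx
    simp only [split, List.mem_append, List.mem_map] at hx
    rcases hx with ⟨y, hy, rfl⟩ | ⟨y, hy, rfl⟩
    · exact ⟨(ihl hul y hy).1, fun h => hl ((rootCircled_of_split hul y hy).2 h), hr,
        (ihl hul y hy).2, hur⟩
    · exact ⟨⟨hl, fun h => hr ((rootCircled_of_split hur y hy).1 h), hul, (ihr hur y hy).1⟩,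
        (ihr hur y hy).2⟩

lemma leftmostCircled_node_iff {c : Bool} {l r : BinaryTree Bool} (hl : 0 < l.numNodes) :
    LeftmostCircled (.node c l r) ↔ LeftmostCircled l := by
  cases l with
  | nil => simp at hl
  | node => rw [LeftmostCircled]

lemma leftmostCircled_of_split {t : BinaryTree Bool} (ht : LeftmostCircled t)
    (hu : CirclesUpClosed t) :
    ∀ x ∈ split t, 0 < x.1.numNodes → LeftmostCircled x.1 := by
  induction t with
  | nil => simp [split]
  | node c l r ihl ihr =>
    obtain ⟨hl, hr, hul, hur⟩ := hu
    intro x hx hpos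
    simp only [split, List.mem_append, List.mem_map] at hx
    rcases hx with ⟨y, hy, rfl⟩ | ⟨y, hy, rfl⟩
    · cases l with
      | nil =>
        simp only [split, List.mem_singleton] at hy
        subst hy
        simp at hpos
      | node c' l' r' => exact ihl (by simpa [LeftmostCircled] using ht) hul y hy hpos
    · cases l with
      | nil =>
        rw [LeftmostCircled] at ht ⊢
        exact ⟨ht.1, fun h => ht.2 ((rootCircled_of_split hur y hy).1 h)⟩
      | node c' l' r' => simpa [LeftmostCircled] using ht

lemma splittings_spec (p : ℕ) {t : BinaryTree Bool} (hu : CirclesUpClosed t) :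
    ∀ f ∈ splittings p t, f.length = p + 1 ∧ (∀ x ∈ f, CirclesUpClosed x) ∧
      (LeftmostCircled t → 0 < (f.headD .nil).numNodes → LeftmostCircled (f.headD .nil)) := by
  induction p generalizing t with
  | zero => simpa [splittings, hu] using fun h _ => h
  | succ p ih =>
    intro f hf
    simp only [splittings, List.mem_flatMap, List.mem_map] at hf
    obtain ⟨x, hx, g, hg, rfl⟩ := hf
    obtain ⟨h1, h2⟩ := circlesUpClosed_of_split hu x hx
    obtain ⟨hlen, hall, -⟩ := ih h2 g hg
    refine ⟨by simp [hlen], ?_, fun ht hpos => ?_⟩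
    · simpa [h1] using hall
    · exact leftmostCircled_of_split ht hu x hx hpos

lemma graft_circlesUpClosed (s : BinaryTree Unit) :
    ∀ f : List (BinaryTree Bool), (∀ x ∈ f, CirclesUpClosed x) →
      CirclesUpClosed (graft f (circleAll s)) := by
  induction s with
  | nil =>
    intro f hf
    cases f with
    | nil => simp [circleAll, BinaryTree.map, graft, CirclesUpClosed]
    | cons x f => simpa [circleAll, BinaryTree.map, graft] using hf x (by simp)
  | node a l r ihl ihr =>
    intro f hf
    simp only [circleAll, BinaryTree.map, graft]
    exact ⟨fun _ => rfl, fun _ => rfl, ihl _ fun x hx => hf x (List.mem_of_mem_take hx),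
      ihr _ fun x hx => hf x (List.mem_of_mem_drop hx)⟩

lemma graft_leftmostCircled (s : BinaryTree Unit) :
    ∀ f : List (BinaryTree Bool), LeftmostCircled (f.headD .nil) →
      LeftmostCircled (graft f (circleAll s)) := by
  induction s with
  | nil => intro f hf; simpa [circleAll, BinaryTree.map, graft] using hf
  | node a l r ihl ihr =>
    intro f hf
    simp only [circleAll, BinaryTree.map, graft]
    have key : LeftmostCircled
        (graft (f.take (l.map fun _ => true).numLeaves) (circleAll l)) := by
      apply ihl
      have hpos := BinaryTree.numLeaves_pos (l.map fun _ => true)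
      cases f with
      | nil => simpa using hf
      | cons x f =>
        obtain ⟨n, hn⟩ := Nat.exists_eq_succ_of_ne_zero hpos.ne'
        simpa [hn] using hf
    rw [leftmostCircled_node_iff]
    · exact key
    · cases h : graft (f.take (l.map fun _ => true).numLeaves) (circleAll l) with
      | nil => rw [h] at key; simp [LeftmostCircled] at key
      | node c l' r' =>
        rw [circleAll] at h
        rw [h]; simp

lemma isBilevel_graft {b : BinaryTree Bool} (hb : IsBilevel b) (s : BinaryTree Unit)
    {f : List (BinaryTree Bool)} (hf : f ∈ restrictedSplittings s.numNodes b) :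
    IsBilevel (graft f (circleAll s)) := by
  simp only [restrictedSplittings, List.mem_filter, decide_eq_true_eq] at hf
  obtain ⟨-, hall, hlm⟩ := splittings_spec _ hb.2 f hf.1
  exact ⟨graft_leftmostCircled s f (hlm hb.1 hf.2), graft_circlesUpClosed s f hall⟩

lemma isBilevel_restrictedSplit {b : BinaryTree Bool} (hb : IsBilevel b)
    {x : BinaryTree Bool × BinaryTree Bool} (hx : x ∈ restrictedSplit b) : IsBilevel x.1 := by
  simp only [restrictedSplit, List.mem_filter, decide_eq_true_eq] at hx
  exact ⟨leftmostCircled_of_split hb.1 hb.2 x hx.1 hx.2, (circlesUpClosed_of_split hb.2 x hx.1).1⟩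

end PlanarTree

/-- The set of bi-leveled trees (with at least one node). -/
abbrev BilevelTree : Type := {b : BinaryTree Bool // PlanarTree.IsBilevel b}

/-! ### The vector spaces `YSym` and `MSym` with their fundamental bases -/

/-- The vector space with fundamental basis `F_t`, for `t` a planar binary tree. -/
abbrev YSym (k : Type*) [Field k] : Type _ := BinaryTree Unit →₀ k

/-- The vector space with fundamental basis `F_b`, for `b` a bi-leveled tree. -/
abbrev MSym (k : Type*) [Field k] : Type _ := BilevelTree →₀ k

namespace YSym

open PlanarTree

noncomputable section

/-- The fundamental basis element `F_t`. -/
def F (k : Type*) [Field k] (t : BinaryTree Unit) : YSym k := Finsupp.single t 1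

/-- The product, `F_t · F_s = ∑ F_{(t₀, …, t_p) / s}` over all `p`-splittings of `t`, where `p` is
the number of nodes of `s`. -/
def mul (k : Type*) [Field k] : YSym k ⊗[k] YSym k →ₗ[k] YSym k :=
  TensorProduct.lift <|
    Finsupp.linearCombination k fun t => Finsupp.linearCombination k fun s =>
      ((splittings s.numNodes t).map fun f => F k (graft f s)).sum

/-- The unit element `1 = F_|`, where `|` is the tree without nodes. -/
def one (k : Type*) [Field k] : YSym k := F k .nil

/-- The coproduct, `Δ(F_t) = ∑ F_{t₀} ⊗ F_{t₁}` over all `1`-splittings of `t`. -/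
def comul (k : Type*) [Field k] : YSym k →ₗ[k] YSym k ⊗[k] YSym k :=
  Finsupp.linearCombination k fun t =>
    ((split t).map fun x => F k x.1 ⊗ₜ[k] F k x.2).sum

/-- The counit, the projection to the component of degree `0`. -/
def counit (k : Type*) [Field k] : YSym k →ₗ[k] k :=
  Finsupp.linearCombination k fun t => if t.numNodes = 0 then 1 else 0

end

end YSym

namespace MSym

open PlanarTree

noncomputable section

/-- The fundamental basis element `F_b`. -/
def F (k : Type*) [Field k] (b : BilevelTree) : MSym k := Finsupp.single b 1

/-- The right action of `YSym` on `MSym`, `F_b · F_s = ∑ F_{(b₀, …, b_p) / s}` over all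
`p`-splittings of `b` with `|b₀| > 0`, where `p` is the number of nodes of `s`; all nodes that
originate in `s` are circled. -/
def act (k : Type*) [Field k] : MSym k ⊗[k] YSym k →ₗ[k] MSym k :=
  TensorProduct.lift <|
    Finsupp.linearCombination k fun b => Finsupp.linearCombination k fun s =>
      ((restrictedSplittings s.numNodes b.1).attach.map fun f =>
        F k ⟨graft f.1 (circleAll s), isBilevel_graft b.2 s f.2⟩).sum

/-- The coaction of `YSym` on `MSym`, `ρ(F_b) = ∑ F_{b₀} ⊗ F_{φ(b₁)}` over all `1`-splittings of `b`
with `|b₀| > 0`, where `φ` forgets the circles. -/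
def coact (k : Type*) [Field k] : MSym k →ₗ[k] MSym k ⊗[k] YSym k :=
  Finsupp.linearCombination k fun b =>
    ((restrictedSplit b.1).attach.map fun x =>
      F k ⟨x.1.1, isBilevel_restrictedSplit b.2 x.2⟩ ⊗ₜ[k] YSym.F k (forget x.1.2)).sum

end

end MSym

/-! ### Hopf modules -/

/-- The space `M`, with an action `act` and a coaction `coact` of `H`, is a right Hopf module over
the Hopf algebra `H` with product `mul`, unit element `one`, coproduct `comul` and counit `counit`:
it is a right module, a right comodule, and the coaction is a morphism of right `H`-modules, where
`H` acts on `M ⊗ H` through its coproduct. -/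
structure IsRightHopfModule {k H M : Type*} [Field k] [AddCommGroup H] [Module k H]
    [AddCommGroup M] [Module k M] (mul : H ⊗[k] H →ₗ[k] H) (one : H)
    (comul : H →ₗ[k] H ⊗[k] H) (counit : H →ₗ[k] k)
    (act : M ⊗[k] H →ₗ[k] M) (coact : M →ₗ[k] M ⊗[k] H) : Prop where
  /-- `(m · g) · h = m · (g h)` -/
  act_assoc : ∀ (m : M) (g h : H), act (act (m ⊗ₜ g) ⊗ₜ h) = act (m ⊗ₜ mul (g ⊗ₜ h))
  /-- `m · 1 = m` -/
  act_one : ∀ m : M, act (m ⊗ₜ one) = m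
  /-- `(ρ ⊗ id) ∘ ρ = (id ⊗ Δ) ∘ ρ` -/
  coact_coassoc : ∀ m : M,
    TensorProduct.assoc k M H H (TensorProduct.map coact LinearMap.id (coact m)) =
      TensorProduct.map LinearMap.id comul (coact m)
  /-- `(id ⊗ ε) ∘ ρ = id` -/
  coact_counit : ∀ m : M,
    TensorProduct.rid k M (TensorProduct.map LinearMap.id counit (coact m)) = m
  /-- `ρ(m · h) = ρ(m) · Δ(h)`, where `(m ⊗ g) · (h ⊗ h') = (m · h) ⊗ (g h')` -/
  coact_act : ∀ (m : M) (h : H),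
    coact (act (m ⊗ₜ h)) =
      TensorProduct.map act mul
        (TensorProduct.tensorTensorTensorComm k M H H H (coact m ⊗ₜ comul h))

/-! Everything rests on one recursion. Among the chosen leaves of a splitting used to multiply by
`node a l r`, a middle one separates the pieces grafted onto `l` from those grafted onto `r`.
Splitting there first gives `t · node a l r = ∑ node a (t₀ · l) (t₁ · r)`, summed over the
`1`-splittings `(t₀, t₁)` of `t` (`listSum_prodTerms_node`). Splitting has a similar recursion over
the two subtrees. Coassociativity says that two leaves may be chosen in either order. From it,
multiplicativity of splitting follows by induction on the second factor, and multiplicativity gives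
associativity by induction on the third.

The restriction `|t₀| > 0` concerns only the leftmost piece, so in each recursion it passes to the
left factor alone. The restricted identities thus follow by the same inductions, with the induction
hypothesis on the left subtree and the unrestricted identity on the right one.

The identities hold for arbitrary decorations and are stated as equal sums of an arbitrary function
`φ` into a commutative monoid. They therefore count multiplicities, and the freedom in `φ` lets the
inductions absorb the rest of the tree into it. Naturality in the decorations handles `forget` and
`circleAll`; bilinearity then reduces the Hopf module axioms to basis vectors. -/

namespace PlanarTree

variable {α β ι κ N : Type*}

/-! ### Sums over lists -/

section ListSum

variable [AddCommMonoid N]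

/-- The sum of the values of `φ` on the entries of a list. -/
def listSum (L : List ι) (φ : ι → N) : N := (L.map φ).sum

@[simp] lemma listSum_nil (φ : ι → N) : listSum [] φ = 0 := rfl

@[simp] lemma listSum_cons (a : ι) (L : List ι) (φ : ι → N) :
    listSum (a :: L) φ = φ a + listSum L φ := by simp [listSum]

lemma listSum_append (L L' : List ι) (φ : ι → N) :
    listSum (L ++ L') φ = listSum L φ + listSum L' φ := by simp [listSum]

lemma listSum_map (L : List ι) (g : ι → κ) (φ : κ → N) :
    listSum (L.map g) φ = listSum L fun x => φ (g x) := by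
  simp [listSum, Function.comp_def]

lemma listSum_flatMap (L : List ι) (g : ι → List κ) (φ : κ → N) :
    listSum (L.flatMap g) φ = listSum L fun x => listSum (g x) φ := by
  induction L with
  | nil => rfl
  | cons a L ih => simp [listSum_append, ih]

lemma listSum_zero (L : List ι) : listSum L (fun _ => (0 : N)) = 0 := by
  induction L with
  | nil => rfl
  | cons a L ih => simp [ih]

lemma listSum_add (L : List ι) (φ ψ : ι → N) :
    listSum L (fun x => φ x + ψ x) = listSum L φ + listSum L ψ := by
  induction L with
  | nil => simp
  | cons a L ih => simp [ih, add_add_add_comm]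

lemma listSum_comm (L : List ι) (L' : List κ) (φ : ι → κ → N) :
    listSum L (fun x => listSum L' fun y => φ x y) =
      listSum L' fun y => listSum L fun x => φ x y := by
  induction L with
  | nil => simp [listSum_zero]
  | cons a L ih => simp [ih, listSum_add]

lemma listSum_congr {L : List ι} {φ ψ : ι → N} (h : ∀ x ∈ L, φ x = ψ x) :
    listSum L φ = listSum L ψ := by
  unfold listSum
  rw [List.map_congr_left h]

lemma listSum_filter (L : List ι) (p : ι → Prop) [DecidablePred p] (φ : ι → N) :
    listSum (L.filter fun x => p x) φ = listSum L fun x => if p x then φ x else 0 := by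
  induction L with
  | nil => rfl
  | cons a L ih => by_cases h : p a <;> simp [h, ih]

lemma map_listSum {N' G : Type*} [AddCommMonoid N'] [FunLike G N N'] [AddMonoidHomClass G N N']
    (g : G) (L : List ι) (φ : ι → N) : g (listSum L φ) = listSum L fun x => g (φ x) := by
  simp [listSum, map_list_sum, Function.comp_def]

end ListSum

/-! ### Splittings -/

lemma numNodes_eq_zero_iff {t : BinaryTree α} : t.numNodes = 0 ↔ t = .nil := by
  cases t <;> simp [BinaryTree.numNodes]

lemma length_of_mem_splittings (p : ℕ) (t : BinaryTree α) :
    ∀ f ∈ splittings p t, f.length = p + 1 := by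
  induction p generalizing t with
  | zero => simp [splittings]
  | succ p ih =>
    intro f hf
    simp only [splittings, List.mem_flatMap, List.mem_map] at hf
    obtain ⟨x, -, g, hg, rfl⟩ := hf
    simp [ih _ g hg]

lemma splittings_leaf (p : ℕ) :
    splittings p (.nil : BinaryTree α) = [List.replicate (p + 1) .nil] := by
  induction p with
  | zero => rfl
  | succ p ih => simp [splittings, split, ih, List.replicate_succ]

section Split

variable [AddCommMonoid N]

lemma listSum_split_node (a : α) (l r : BinaryTree α) (φ : BinaryTree α × BinaryTree α → N) :
    listSum (split (.node a l r)) φ =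
      listSum (split l) (fun x => φ (x.1, .node a x.2 r)) +
        listSum (split r) fun x => φ (.node a l x.1, x.2) := by
  simp [split, listSum_append, listSum_map]

/-- A leaf of `r` leaves the root in the first piece, so the restriction is vacuous there; a leaf of
`l` yields the first piece of a splitting of `l`. -/
lemma listSum_restrictedSplit_node (a : α) (l r : BinaryTree α)
    (φ : BinaryTree α × BinaryTree α → N) :
    listSum (restrictedSplit (.node a l r)) φ =
      listSum (restrictedSplit l) (fun x => φ (x.1, .node a x.2 r)) +
        listSum (split r) fun x => φ (.node a l x.1, x.2) := by
  simp only [restrictedSplit, listSum_filter, listSum_split_node]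
  simp

/-- Coassociativity of splitting. -/
lemma listSum_split_coassoc (t : BinaryTree α)
    (φ : BinaryTree α → BinaryTree α → BinaryTree α → N) :
    (listSum (split t) fun x => listSum (split x.1) fun y => φ y.1 y.2 x.2) =
      listSum (split t) fun x => listSum (split x.2) fun y => φ x.1 y.1 y.2 := by
  induction t generalizing φ with
  | nil => simp [split]
  | node a l r ihl ihr =>
    simp only [listSum_split_node, listSum_add, ihl fun x y z => φ x y (.node a z r),
      ← ihr fun x y z => φ (.node a l x) y z, add_assoc]
    -- The remaining mixed term has one leaf in each subtree, chosen independently.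
    rw [listSum_comm (split r) (split l)]

/-- Coassociativity of restricted splitting. -/
lemma listSum_restrictedSplit_coassoc (t : BinaryTree α)
    (φ : BinaryTree α → BinaryTree α → BinaryTree α → N) :
    (listSum (restrictedSplit t) fun x => listSum (restrictedSplit x.1) fun y => φ y.1 y.2 x.2) =
      listSum (restrictedSplit t) fun x => listSum (split x.2) fun y => φ x.1 y.1 y.2 := by
  induction t generalizing φ with
  | nil => simp [restrictedSplit, split]
  | node a l r ihl _ =>
    simp only [listSum_restrictedSplit_node, listSum_split_node, listSum_add,
      ihl fun x y z => φ x y (.node a z r),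
      ← listSum_split_coassoc r fun x y z => φ (.node a l x) y z, add_assoc]
    rw [listSum_comm (split r) (restrictedSplit l)]

/-- Splitting at `p + q + 1` leaves amounts to splitting at the `p`-th of them first. -/
lemma listSum_splittings_add (p q : ℕ) (t : BinaryTree α) (φ : List (BinaryTree α) → N) :
    listSum (splittings (p + q + 1) t) φ =
      listSum (split t) fun x => listSum (splittings p x.1) fun f =>
        listSum (splittings q x.2) fun g => φ (f ++ g) := by
  induction p generalizing t φ with
  | zero => simp [splittings, listSum_flatMap, listSum_map]
  | succ p ih =>
    have succ (n : ℕ) (t : BinaryTree α) (ψ : List (BinaryTree α) → N) :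
        listSum (splittings (n + 1) t) ψ =
          listSum (split t) fun x => listSum (splittings n x.2) fun f => ψ (x.1 :: f) := by
      simp only [splittings, listSum_flatMap, listSum_map]
    rw [show p + 1 + q + 1 = (p + q + 1) + 1 by omega, succ]
    simp only [ih, succ p]
    -- The leftmost leaf and the separating leaf may be chosen in either order.
    exact (listSum_split_coassoc t fun x y z => listSum (splittings p y) fun f =>
      listSum (splittings q z) fun g => φ (x :: (f ++ g))).symm

lemma listSum_split_eq_restrictedSplit (t : BinaryTree α) (φ : BinaryTree α × BinaryTree α → N)
    (h : ∀ t, φ (.nil, t) = 0) : listSum (split t) φ = listSum (restrictedSplit t) φ := by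
  rw [restrictedSplit, listSum_filter]
  refine listSum_congr fun x _ => ?_
  split_ifs with hx
  · rfl
  · obtain ⟨x, y⟩ := x
    obtain rfl := numNodes_eq_zero_iff.1 (by simpa using hx)
    exact h y

end Split

/-! ### The product of two trees -/

/-- The terms of the product of two trees. -/
def prodTerms (t s : BinaryTree α) : List (BinaryTree α) :=
  (splittings s.numNodes t).map fun f => graft f s

/-- The terms of the restricted product of two trees. -/
def restrictedProdTerms (t s : BinaryTree α) : List (BinaryTree α) :=
  (restrictedSplittings s.numNodes t).map fun f => graft f s

lemma prodTerms_leaf (t : BinaryTree α) : prodTerms t .nil = [t] := by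
  simp [prodTerms, splittings, graft]

lemma restrictedProdTerms_leaf {t : BinaryTree α} (h : 0 < t.numNodes) :
    restrictedProdTerms t .nil = [t] := by
  simp [restrictedProdTerms, restrictedSplittings, splittings, graft, h]

lemma leaf_restrictedProdTerms (s : BinaryTree α) : restrictedProdTerms .nil s = [] := by
  simp [restrictedProdTerms, restrictedSplittings, splittings_leaf, List.replicate_succ]

lemma graft_append_node (a : α) (l r : BinaryTree α) {f g : List (BinaryTree α)}
    (hf : f.length = l.numNodes + 1) :
    graft (f ++ g) (.node a l r) = .node a (graft f l) (graft g r) := by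
  have : l.numLeaves = f.length := by rw [hf, BinaryTree.numLeaves_eq_numNodes_succ]
  simp [graft, this]

lemma pos_numNodes_graft (s : BinaryTree α) (f : List (BinaryTree α))
    (h : 0 < (f.headD .nil).numNodes) : 0 < (graft f s).numNodes := by
  cases s with
  | nil => simpa [graft] using h
  | node => simp [graft, BinaryTree.numNodes]

lemma pos_numNodes_of_mem_restrictedProdTerms {t s x : BinaryTree α}
    (h : x ∈ restrictedProdTerms t s) : 0 < x.numNodes := by
  simp only [restrictedProdTerms, restrictedSplittings, List.mem_map, List.mem_filter,
    decide_eq_true_eq] at h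
  obtain ⟨f, hf, rfl⟩ := h
  exact pos_numNodes_graft s f hf.2

section Product

variable [AddCommMonoid N]

/-- Since `node a l r` has `l.numNodes + r.numNodes + 1` nodes, `listSum_splittings_add` can split
first at the leaf that separates the forests for `l` and `r`. -/
lemma listSum_prodTerms_node (t : BinaryTree α) (a : α) (l r : BinaryTree α)
    (φ : BinaryTree α → N) :
    listSum (prodTerms t (.node a l r)) φ =
      listSum (split t) fun x => listSum (prodTerms x.1 l) fun y =>
        listSum (prodTerms x.2 r) fun z => φ (.node a y z) := by
  simp only [prodTerms, BinaryTree.numNodes, listSum_map, listSum_splittings_add]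
  refine listSum_congr fun x _ => listSum_congr fun f hf => listSum_congr fun g _ => ?_
  rw [graft_append_node a l r (length_of_mem_splittings _ _ f hf)]

lemma listSum_restrictedProdTerms_node (t : BinaryTree α) (a : α) (l r : BinaryTree α)
    (φ : BinaryTree α → N) :
    listSum (restrictedProdTerms t (.node a l r)) φ =
      listSum (restrictedSplit t) fun x => listSum (restrictedProdTerms x.1 l) fun y =>
        listSum (prodTerms x.2 r) fun z => φ (.node a y z) := by
  -- A first piece without nodes has an empty restricted product with `l`, so restricting the outer
  -- splitting changes nothing.
  rw [← listSum_split_eq_restrictedSplit]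
  · simp only [prodTerms, restrictedProdTerms, restrictedSplittings, BinaryTree.numNodes,
      listSum_map, listSum_filter, listSum_splittings_add]
    refine listSum_congr fun x _ => listSum_congr fun f hf => ?_
    have hlen := length_of_mem_splittings _ _ f hf
    -- The forest `f` is nonempty, so the restriction on `f ++ g` is a restriction on `f` alone.
    have hhead (g : List (BinaryTree α)) : (f ++ g).headD .nil = f.headD .nil := by
      cases f with
      | nil => simp at hlen
      | cons => rfl
    simp only [hhead, graft_append_node a l r hlen]
    split_ifs
    · rfl
    · exact listSum_zero _
  · simp [leaf_restrictedProdTerms]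

/-- Splitting is multiplicative. -/
lemma listSum_prodTerms_split (t s : BinaryTree α) (φ : BinaryTree α × BinaryTree α → N) :
    (listSum (prodTerms t s) fun x => listSum (split x) φ) =
      listSum (split t) fun x => listSum (split s) fun y =>
        listSum (prodTerms x.1 y.1) fun u => listSum (prodTerms x.2 y.2) fun v => φ (u, v) := by
  induction s generalizing t φ with
  | nil => simp [prodTerms_leaf, split]
  | node a l r ihl ihr =>
    simp only [listSum_prodTerms_node, listSum_split_node, listSum_add]
    -- The leaf at which a term is split lies over `l` or over `r`.
    congr 1
    · have swap (c d : BinaryTree α) (ψ : BinaryTree α → BinaryTree α × BinaryTree α → N) :=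
        listSum_comm (prodTerms c r) (split d) ψ
      simp only [swap, ihl]
      -- The induction hypothesis splits the first piece of `t` again, whereas the right side splits
      -- the second piece.
      rw [listSum_split_coassoc t fun x y z => listSum (split l) fun w =>
        listSum (prodTerms x w.1) fun u => listSum (prodTerms y w.2) fun v =>
          listSum (prodTerms z r) fun w => φ (u, .node a v w)]
      refine listSum_congr fun x _ => ?_
      rw [listSum_comm]
      refine listSum_congr fun y _ => ?_
      rw [listSum_comm]
    · have swap (c d : BinaryTree α) (ψ : BinaryTree α → BinaryTree α × BinaryTree α → N) :=
        listSum_comm (prodTerms c l) (split d) ψ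
      simp only [ihr _ fun x => φ (.node a _ x.1, x.2), swap]
      rw [← listSum_split_coassoc t fun x y z => listSum (split r) fun w =>
        listSum (prodTerms x l) fun u => listSum (prodTerms y w.1) fun v =>
          listSum (prodTerms z w.2) fun w => φ (.node a u v, w)]
      refine listSum_congr fun x _ => ?_
      rw [listSum_comm]

/-- Restricted splitting is multiplicative. -/
lemma listSum_restrictedProdTerms_restrictedSplit (t s : BinaryTree α)
    (φ : BinaryTree α × BinaryTree α → N) :
    (listSum (restrictedProdTerms t s) fun x => listSum (restrictedSplit x) φ) =
      listSum (restrictedSplit t) fun x => listSum (split s) fun y =>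
        listSum (restrictedProdTerms x.1 y.1) fun u =>
          listSum (prodTerms x.2 y.2) fun v => φ (u, v) := by
  induction s generalizing t φ with
  | nil =>
    by_cases ht : 0 < t.numNodes
    · simp only [restrictedProdTerms_leaf ht, split, prodTerms_leaf, listSum_cons, listSum_nil,
        add_zero]
      refine listSum_congr fun x hx => ?_
      have hx : 0 < x.1.numNodes := by simpa using (List.mem_filter.1 hx).2
      simp [restrictedProdTerms_leaf hx]
    · obtain rfl := numNodes_eq_zero_iff.1 (by simpa using ht)
      simp [leaf_restrictedProdTerms, restrictedSplit, split]
  | node a l r ihl _ =>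
    simp only [listSum_restrictedProdTerms_node, listSum_restrictedSplit_node, listSum_split_node,
      listSum_add]
    congr 1
    · have swap (c d : BinaryTree α) (ψ : BinaryTree α → BinaryTree α × BinaryTree α → N) :=
        listSum_comm (prodTerms c r) (restrictedSplit d) ψ
      simp only [swap, ihl]
      rw [listSum_restrictedSplit_coassoc t fun x y z => listSum (split l) fun w =>
        listSum (restrictedProdTerms x w.1) fun u => listSum (prodTerms y w.2) fun v =>
          listSum (prodTerms z r) fun w => φ (u, .node a v w)]
      simp only [listSum_prodTerms_node]
      refine listSum_congr fun x _ => ?_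
      rw [listSum_comm]
      refine listSum_congr fun y _ => ?_
      rw [listSum_comm]
    · have swap (c d : BinaryTree α) (ψ : BinaryTree α → BinaryTree α × BinaryTree α → N) :=
        listSum_comm (restrictedProdTerms c l) (split d) ψ
      -- The factor over `r` is unrestricted, so the unrestricted multiplicativity replaces an
      -- induction hypothesis.
      simp only [listSum_prodTerms_split _ r, swap]
      rw [← listSum_restrictedSplit_coassoc t fun x y z => listSum (split r) fun w =>
        listSum (restrictedProdTerms x l) fun u => listSum (prodTerms y w.1) fun v =>
          listSum (prodTerms z w.2) fun w => φ (.node a u v, w)]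
      refine listSum_congr fun x _ => ?_
      rw [listSum_comm]

/-- Associativity of the product. -/
lemma listSum_prodTerms_assoc (t s u : BinaryTree α) (φ : BinaryTree α → N) :
    (listSum (prodTerms t s) fun x => listSum (prodTerms x u) φ) =
      listSum (prodTerms s u) fun y => listSum (prodTerms t y) φ := by
  induction u generalizing t s φ with
  | nil => simp [prodTerms_leaf]
  | node a l r ihl ihr =>
    simp only [listSum_prodTerms_node]
    -- Instead of splitting the terms of `t · s`, split `t` and `s` separately; what remains is
    -- associativity with third factors `l` and `r`.
    rw [listSum_prodTerms_split t s fun x => listSum (prodTerms x.1 l) fun v =>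
      listSum (prodTerms x.2 r) fun w => φ (.node a v w)]
    have swap (c d d' : BinaryTree α) (ψ : BinaryTree α → BinaryTree α → N) :=
      listSum_comm (prodTerms c d) (prodTerms d' l) ψ
    simp only [swap, ihr, ihl]
    rw [listSum_comm (split t)]
    refine listSum_congr fun y _ => ?_
    simp only [← listSum_comm (split t)]
    refine listSum_congr fun x _ => listSum_congr fun u _ => ?_
    rw [listSum_comm]

/-- Associativity of the restricted product. -/
lemma listSum_restrictedProdTerms_assoc (t s u : BinaryTree α) (φ : BinaryTree α → N) :
    (listSum (restrictedProdTerms t s) fun x => listSum (restrictedProdTerms x u) φ) =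
      listSum (prodTerms s u) fun y => listSum (restrictedProdTerms t y) φ := by
  induction u generalizing t s φ with
  | nil =>
    simp only [prodTerms_leaf, listSum_cons, listSum_nil, add_zero]
    -- The leaf acts as the identity only on trees with a node, which the terms of a restricted
    -- product are.
    refine listSum_congr fun x hx => ?_
    simp [restrictedProdTerms_leaf (pos_numNodes_of_mem_restrictedProdTerms hx)]
  | node a l r ihl _ =>
    simp only [listSum_prodTerms_node, listSum_restrictedProdTerms_node]
    rw [listSum_restrictedProdTerms_restrictedSplit t s fun x => listSum (restrictedProdTerms x.1 l) fun v =>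
      listSum (prodTerms x.2 r) fun w => φ (.node a v w)]
    have swap (c d d' : BinaryTree α) (ψ : BinaryTree α → BinaryTree α → N) :=
      listSum_comm (prodTerms c d) (restrictedProdTerms d' l) ψ
    simp only [swap, listSum_prodTerms_assoc _ _ r, ihl]
    rw [listSum_comm (restrictedSplit t)]
    refine listSum_congr fun y _ => ?_
    simp only [← listSum_comm (restrictedSplit t)]
    refine listSum_congr fun x _ => listSum_congr fun u _ => ?_
    rw [listSum_comm]

end Product

/-! ### Naturality in the decorations -/

lemma numNodes_map (g : α → β) (t : BinaryTree α) : (t.map g).numNodes = t.numNodes := by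
  induction t <;> simp_all [BinaryTree.map, BinaryTree.numNodes]

lemma split_map (g : α → β) (t : BinaryTree α) :
    split (t.map g) = (split t).map fun x => (x.1.map g, x.2.map g) := by
  induction t <;> simp_all [BinaryTree.map, split, Function.comp_def]

lemma splittings_map (g : α → β) (p : ℕ) (t : BinaryTree α) :
    splittings p (t.map g) = (splittings p t).map (List.map (BinaryTree.map g)) := by
  induction p generalizing t with
  | zero => simp [splittings]
  | succ p ih =>
    simp [splittings, split_map, ih, List.flatMap_map, List.map_flatMap, Function.comp_def]

lemma graft_map (g : α → β) (s : BinaryTree α) (f : List (BinaryTree α)) :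
    graft (f.map (BinaryTree.map g)) (s.map g) = (graft f s).map g := by
  induction s generalizing f with
  | nil => cases f <;> simp [BinaryTree.map, graft]
  | node a l r ihl ihr =>
    simp [BinaryTree.map, graft, BinaryTree.numLeaves_eq_numNodes_succ, numNodes_map,
      ← List.map_take, ← List.map_drop, ihl, ihr]

lemma prodTerms_map (g : α → β) (t s : BinaryTree α) :
    prodTerms (t.map g) (s.map g) = (prodTerms t s).map (BinaryTree.map g) := by
  simp [prodTerms, splittings_map, graft_map, numNodes_map, Function.comp_def]

lemma forget_circleAll (s : BinaryTree Unit) : forget (circleAll s) = s := by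
  unfold forget circleAll
  induction s <;> simp_all [BinaryTree.map]

/-- This matches the second tensor factor of the coaction, where circles are forgotten before
multiplying, with the identities for circled trees. -/
lemma prodTerms_forget (b : BinaryTree Bool) (s : BinaryTree Unit) :
    prodTerms (forget b) s = (prodTerms b (circleAll s)).map forget := by
  conv_lhs => rw [← forget_circleAll s]
  exact prodTerms_map _ _ _

end PlanarTree

/-! ### Bi-leveled product terms, counit identities and tensors of sums -/

namespace PlanarTree

variable {α N : Type*}

lemma isBilevel_of_mem_restrictedProdTerms {b : BinaryTree Bool} (hb : IsBilevel b)
    {s : BinaryTree Unit} {x : BinaryTree Bool} (hx : x ∈ restrictedProdTerms b (circleAll s)) :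
    IsBilevel x := by
  obtain ⟨f, hf, rfl⟩ := List.mem_map.1 hx
  rw [circleAll, numNodes_map] at hf
  exact isBilevel_graft hb s hf

lemma IsBilevel.pos_numNodes {b : BinaryTree Bool} (hb : IsBilevel b) : 0 < b.numNodes := by
  cases b with
  | nil => exact hb.1.elim
  | node => simp

/-- Only the rightmost leaf gives a second piece without nodes, and its first piece is the whole
tree. -/
lemma listSum_split_ite_leaf [AddCommMonoid N] (t : BinaryTree α) (φ : BinaryTree α → N) :
    (listSum (split t) fun x => if x.2.numNodes = 0 then φ x.1 else 0) = φ t := by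
  induction t generalizing φ with
  | nil => simp [split]
  | node a l r _ ihr =>
    rw [listSum_split_node]
    simpa [listSum_zero] using ihr fun x => φ (.node a l x)

lemma listSum_restrictedSplit_ite_leaf [AddCommMonoid N] {t : BinaryTree α} (ht : 0 < t.numNodes)
    (φ : BinaryTree α → N) :
    (listSum (restrictedSplit t) fun x => if x.2.numNodes = 0 then φ x.1 else 0) = φ t := by
  have key := listSum_split_ite_leaf t fun x => if 0 < x.numNodes then φ x else 0
  rw [if_pos ht] at key
  rw [restrictedSplit, listSum_filter, ← key]
  refine listSum_congr fun x _ => ?_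
  split_ifs <;> rfl

lemma listSum_tmul_listSum {k M M' ι κ : Type*} [CommSemiring k] [AddCommMonoid M] [Module k M]
    [AddCommMonoid M'] [Module k M'] (L : List ι) (L' : List κ) (φ : ι → M) (ψ : κ → M') :
    listSum L φ ⊗ₜ[k] listSum L' ψ = listSum L fun x => listSum L' fun y => φ x ⊗ₜ[k] ψ y := by
  have h (m : M) : m ⊗ₜ[k] listSum L' ψ = listSum L' fun y => m ⊗ₜ[k] ψ y :=
    map_listSum (TensorProduct.mk k M M' m) L' ψ
  have h' (m' : M') : listSum L φ ⊗ₜ[k] m' = listSum L fun x => φ x ⊗ₜ[k] m' :=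
    map_listSum ((TensorProduct.mk k M M').flip m') L φ
  simp only [h', h]

end PlanarTree

/-! ### Reduction to basis vectors -/

open PlanarTree

/-- A property of vectors that is preserved under linear combinations holds if it holds for basis
vectors. -/
lemma Finsupp.induction_basis {k ι : Type*} [Semiring k] [Nonempty ι] {p : (ι →₀ k) → Prop}
    (x : ι →₀ k) (single : ∀ i, p (Finsupp.single i 1)) (add : ∀ x y, p x → p y → p (x + y))
    (smul : ∀ (c : k) x, p x → p (c • x)) : p x := by
  induction x using Finsupp.induction_linear with
  -- Zero is `0` times some basis vector, which is why the index type must be nonempty.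
  | zero => simpa using smul 0 _ (single (Classical.arbitrary ι))
  | add x y hx hy => exact add x y hx hy
  | single i c => simpa using smul c _ (single i)

instance : Nonempty BilevelTree :=
  ⟨⟨.node true .nil .nil, by
    simp [IsBilevel, LeftmostCircled, CirclesUpClosed, RootCircled]⟩⟩

/-! ### Structure maps of `YSym` on the basis -/

namespace YSym

variable (k : Type*) [Field k]

lemma mul_F (t s : BinaryTree Unit) :
    mul k (F k t ⊗ₜ F k s) = listSum (prodTerms t s) (F k) := by
  simp [mul, F, prodTerms, listSum, Function.comp_def]

lemma comul_F (t : BinaryTree Unit) :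
    comul k (F k t) = listSum (split t) fun x => F k x.1 ⊗ₜ F k x.2 := by
  simp [comul, F, listSum]

lemma counit_F (t : BinaryTree Unit) :
    counit k (F k t) = if t.numNodes = 0 then 1 else 0 := by
  simp [counit, F]

end YSym

/-! ### The Hopf module axioms for `MSym` -/

namespace MSym

variable (k : Type*) [Field k]

open Classical in
/-- The fundamental basis element of a bi-leveled tree, and `0` for the other trees. -/
noncomputable def ofTree (b : BinaryTree Bool) : MSym k :=
  if h : IsBilevel b then F k ⟨b, h⟩ else 0

variable {k}

lemma ofTree_eq {b : BinaryTree Bool} (h : IsBilevel b) : ofTree k b = F k ⟨b, h⟩ := dif_pos h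

/-- Through `ofTree`, the sum over a list with attached proofs becomes a sum over plain trees, to
which the combinatorial identities apply. -/
lemma act_ofTree {b : BinaryTree Bool} (hb : IsBilevel b) (s : BinaryTree Unit) :
    act k (ofTree k b ⊗ₜ YSym.F k s) =
      listSum (restrictedProdTerms b (circleAll s)) (ofTree k) := by
  have h (f : {f // f ∈ restrictedSplittings s.numNodes b}) :
      F k ⟨graft f.1 (circleAll s), isBilevel_graft hb s f.2⟩ =
        ofTree k (graft f.1 (circleAll s)) := (ofTree_eq _).symm
  have hn : (circleAll s).numNodes = s.numNodes := numNodes_map _ s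
  rw [ofTree_eq hb, restrictedProdTerms, hn, listSum_map, listSum,
    ← List.attach_map_val (l := restrictedSplittings s.numNodes b)]
  simp only [← h]
  simp [act, F, YSym.F]

lemma coact_ofTree {b : BinaryTree Bool} (hb : IsBilevel b) :
    coact k (ofTree k b) =
      listSum (restrictedSplit b) fun x => ofTree k x.1 ⊗ₜ YSym.F k (forget x.2) := by
  have h (x : {x // x ∈ restrictedSplit b}) :
      F k ⟨x.1.1, isBilevel_restrictedSplit hb x.2⟩ = ofTree k x.1.1 := (ofTree_eq _).symm
  rw [ofTree_eq hb, listSum, ← List.attach_map_val (l := restrictedSplit b)]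
  simp only [← h]
  simp [coact, F]

theorem act_assoc (m : MSym k) (g h : YSym k) :
    act k (act k (m ⊗ₜ g) ⊗ₜ h) = act k (m ⊗ₜ YSym.mul k (g ⊗ₜ h)) := by
  induction m using Finsupp.induction_basis with
  | add m m' hm hm' => simp only [TensorProduct.add_tmul, map_add, hm, hm']
  | smul c m hm => simp only [← TensorProduct.smul_tmul', map_smul, hm]
  | single b =>
  induction g using Finsupp.induction_basis with
  | add m m' hm hm' => simp only [TensorProduct.add_tmul, TensorProduct.tmul_add, map_add, hm, hm']
  | smul c m hm => simp only [← TensorProduct.smul_tmul', TensorProduct.tmul_smul, map_smul, hm]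
  | single s =>
  induction h using Finsupp.induction_basis with
  | add m m' hm hm' => simp only [TensorProduct.tmul_add, map_add, hm, hm']
  | smul c m hm => simp only [TensorProduct.tmul_smul, map_smul, hm]
  | single u =>
  change act k (act k (F k b ⊗ₜ YSym.F k s) ⊗ₜ YSym.F k u) =
    act k (F k b ⊗ₜ YSym.mul k (YSym.F k s ⊗ₜ YSym.F k u))
  have hl (L : List (BinaryTree Bool)) (φ : BinaryTree Bool → MSym k) :
      act k (listSum L φ ⊗ₜ YSym.F k u) = listSum L fun x => act k (φ x ⊗ₜ YSym.F k u) :=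
    map_listSum (act k ∘ₗ (TensorProduct.mk k _ _).flip (YSym.F k u)) L φ
  have hr (m : MSym k) (L : List (BinaryTree Unit)) (φ : BinaryTree Unit → YSym k) :
      act k (m ⊗ₜ listSum L φ) = listSum L fun x => act k (m ⊗ₜ φ x) :=
    map_listSum (act k ∘ₗ TensorProduct.mk k _ _ m) L φ
  -- By naturality, circling the terms of the product of `s` and `u` gives the product of the
  -- circled trees, so all three factors are trees with circles.
  rw [← ofTree_eq b.2, act_ofTree b.2, YSym.mul_F, hl, hr,
    listSum_congr fun x hx => act_ofTree (isBilevel_of_mem_restrictedProdTerms b.2 hx) u,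
    listSum_restrictedProdTerms_assoc, circleAll, circleAll, prodTerms_map, listSum_map]
  exact listSum_congr fun x _ => (act_ofTree b.2 x).symm

theorem act_one (m : MSym k) : act k (m ⊗ₜ YSym.one k) = m := by
  induction m using Finsupp.induction_basis with
  | add m m' hm hm' => simp only [TensorProduct.add_tmul, map_add, hm, hm']
  | smul c m hm => simp only [← TensorProduct.smul_tmul', map_smul, hm]
  | single b =>
  change act k (F k b ⊗ₜ YSym.F k .nil) = F k b
  rw [← ofTree_eq b.2, act_ofTree b.2, circleAll, BinaryTree.map,
    restrictedProdTerms_leaf b.2.pos_numNodes]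
  simp

theorem coact_coassoc (m : MSym k) :
    TensorProduct.assoc k (MSym k) (YSym k) (YSym k)
        (TensorProduct.map (coact k) LinearMap.id (coact k m)) =
      TensorProduct.map LinearMap.id (YSym.comul k) (coact k m) := by
  induction m using Finsupp.induction_basis with
  | add m m' hm hm' => simp only [map_add, hm, hm']
  | smul c m hm => simp only [map_smul, hm]
  | single b =>
  have hl (L : List (BinaryTree Bool × BinaryTree Bool))
      (φ : BinaryTree Bool × BinaryTree Bool → MSym k ⊗[k] YSym k) (h : YSym k) :
      TensorProduct.assoc k _ _ _ (listSum L φ ⊗ₜ[k] h) =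
        listSum L fun x => TensorProduct.assoc k _ _ _ (φ x ⊗ₜ[k] h) :=
    map_listSum ((TensorProduct.assoc k _ _ _).toLinearMap ∘ₗ
      (TensorProduct.mk k (MSym k ⊗[k] YSym k) (YSym k)).flip h) L φ
  have hr (m : MSym k) (L : List (BinaryTree Bool × BinaryTree Bool))
      (φ : BinaryTree Bool × BinaryTree Bool → YSym k ⊗[k] YSym k) :
      m ⊗ₜ[k] listSum L φ = listSum L fun x => m ⊗ₜ[k] φ x :=
    map_listSum (TensorProduct.mk k (MSym k) (YSym k ⊗[k] YSym k) m) L φ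
  change TensorProduct.assoc k _ _ _ (TensorProduct.map (coact k) LinearMap.id
    (coact k (F k b))) = TensorProduct.map LinearMap.id (YSym.comul k) (coact k (F k b))
  rw [← ofTree_eq b.2, coact_ofTree b.2]
  simp only [map_listSum, TensorProduct.map_tmul, LinearMap.id_apply, YSym.comul_F]
  -- Splitting commutes with forgetting circles, so the coproduct may split the circled second
  -- piece.
  simp only [forget, split_map, listSum_map, hr]
  refine .trans ?_ (listSum_restrictedSplit_coassoc b.1 fun x y z =>
    ofTree k x ⊗ₜ[k] (YSym.F k (forget y) ⊗ₜ[k] YSym.F k (forget z)))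
  refine listSum_congr fun x hx => ?_
  rw [coact_ofTree (isBilevel_restrictedSplit b.2 hx), hl]
  simp only [TensorProduct.assoc_tmul, forget]

theorem coact_counit (m : MSym k) :
    TensorProduct.rid k (MSym k)
      (TensorProduct.map LinearMap.id (YSym.counit k) (coact k m)) = m := by
  induction m using Finsupp.induction_basis with
  | add m m' hm hm' => simp only [map_add, hm, hm']
  | smul c m hm => simp only [map_smul, hm]
  | single b =>
  change TensorProduct.rid k _ (TensorProduct.map LinearMap.id (YSym.counit k)
    (coact k (F k b))) = F k b
  rw [← ofTree_eq b.2, coact_ofTree b.2]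
  simp only [map_listSum, TensorProduct.map_tmul, LinearMap.id_apply, YSym.counit_F,
    TensorProduct.rid_tmul, forget, numNodes_map, ite_smul, one_smul, zero_smul]
  exact listSum_restrictedSplit_ite_leaf b.2.pos_numNodes (ofTree k)

theorem coact_act (m : MSym k) (h : YSym k) :
    coact k (act k (m ⊗ₜ h)) =
      TensorProduct.map (act k) (YSym.mul k)
        (TensorProduct.tensorTensorTensorComm k (MSym k) (YSym k) (YSym k) (YSym k)
          (coact k m ⊗ₜ YSym.comul k h)) := by
  induction m using Finsupp.induction_basis with
  | add m m' hm hm' => simp only [TensorProduct.add_tmul, map_add, hm, hm']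
  | smul c m hm => simp only [← TensorProduct.smul_tmul', map_smul, hm]
  | single b =>
  induction h using Finsupp.induction_basis with
  | add m m' hm hm' => simp only [TensorProduct.tmul_add, map_add, hm, hm']
  | smul c m hm => simp only [TensorProduct.tmul_smul, map_smul, hm]
  | single s =>
  change coact k (act k (F k b ⊗ₜ YSym.F k s)) = TensorProduct.map (act k) (YSym.mul k)
    (TensorProduct.tensorTensorTensorComm k _ _ _ _ (coact k (F k b) ⊗ₜ YSym.comul k (YSym.F k s)))
  rw [← ofTree_eq b.2, act_ofTree b.2, coact_ofTree b.2, YSym.comul_F, listSum_tmul_listSum,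
    map_listSum,
    listSum_congr fun x hx => coact_ofTree (isBilevel_of_mem_restrictedProdTerms b.2 hx),
    listSum_restrictedProdTerms_restrictedSplit, circleAll, split_map]
  simp only [map_listSum, listSum_map, TensorProduct.tensorTensorTensorComm_tmul,
    TensorProduct.map_tmul]
  refine listSum_congr fun x hx => listSum_congr fun y _ => ?_
  rw [act_ofTree (isBilevel_restrictedSplit b.2 hx), YSym.mul_F, listSum_tmul_listSum,
    prodTerms_forget]
  simp only [listSum_map, circleAll]

end MSym

theorem theorem2 (k : Type*) [Field k] [CharZero k] :
    IsRightHopfModule (YSym.mul k) (YSym.one k) (YSym.comul k) (YSym.counit k)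
      (MSym.act k) (MSym.coact k) where
  act_assoc := MSym.act_assoc
  act_one := MSym.act_one
  coact_coassoc := MSym.coact_coassoc
  coact_counit := MSym.coact_counit
  coact_act := MSym.coact_act
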